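/- All posets are finite, and the dimension $\dim(P)$ of a poset $P$ is the least positive integer $k$ for which there are $k$ linear extensions $L_1,\dots,L_k$ of $P$ such that $x\le y$ in $P$ if and only if $x\le y$ in every $L_i$. The cover graph of $P$ has the elements of $P$ as vertices, two elements being adjacent when one of them covers the other. A block of a graph is a maximal connected subgraph without a cut vertex (so a bridge, or an isolated vertex, is a block). A subset $B$ of $P$, with the induced order, is a convex subposet if $y\in B$ whenever $x,z\in B$ and $x<y<z$ in $P$; a block of $P$ is a convex subposet $B$ whose cover graph is a block of the cover graph of $P$. Theorem. For every integer $d\ge 1$, if $P$ is a poset and every block of $P$ has dimension at most $d$, then $\dim(P)\le d+2$. Furthermore, this inequality is best possible: for every $d\ge 1$ there is a poset $P$ such that every block of $P$ has dimension at most $d$ and $\dim(P)=d+2$. -/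

import Mathlib

namespace PosetBlocks

/-- A binary relation `r` is a linear extension of the partial order on `P` when it is a
(reflexive) linear order on `P` that contains the order of `P`. -/
structure IsLinearExtension {P : Type*} [PartialOrder P] (r : P → P → Prop) : Prop where
  refl : ∀ x, r x x
  antisymm : ∀ x y, r x y → r y x → x = y
  trans : ∀ x y z, r x y → r y z → r x z
  total : ∀ x y, r x y ∨ r y x
  extends_le : ∀ x y, x ≤ y → r x y

/-- A family `L` of linear extensions (repetitions allowed) is a realizer of `P` when
`x ≤ y` holds in `P` if and only if it holds in every member of the family. -/
def IsRealizer {P : Type*} [PartialOrder P] {k : ℕ} (L : Fin k → P → P → Prop) : Prop :=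
  (∀ i, IsLinearExtension (L i)) ∧ ∀ x y, x ≤ y ↔ ∀ i, L i x y

/-- The (order) dimension: the least positive integer `k` such that `P` has a realizer of size
`k`, and `⊤` when there is no such integer (which never happens for a finite poset). -/
noncomputable def dim (P : Type*) [PartialOrder P] : ℕ∞ :=
  sInf {n : ℕ∞ | ∃ k : ℕ, n = k ∧ 0 < k ∧ ∃ L : Fin k → P → P → Prop, IsRealizer L}

/-- A graph is nonseparable when it is connected and has no cut vertex. This is `2`-connectedness
with the convention, usual when speaking of blocks, that a single vertex and a single edge
are admitted. -/
def IsNonseparable {V : Type*} (G : SimpleGraph V) : Prop :=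
  G.Connected ∧ ∀ v : V, (G.induce {v}ᶜ).Preconnected

/-- A block of a graph is an induced nonseparable subgraph which is not a proper subgraph
of a nonseparable subgraph. -/
def IsGraphBlock {V : Type*} {G : SimpleGraph V} (H : G.Subgraph) : Prop :=
  H.IsInduced ∧ IsNonseparable H.coe ∧ ∀ H' : G.Subgraph, H < H' → ¬ IsNonseparable H'.coe

/-- The cover graph of a convex subposet `B` is the subgraph of the cover graph of `P`
induced on `B`. -/
theorem hasse_eq_induce {P : Type*} [PartialOrder P] (B : Set P) (hB : B.OrdConnected) :
    SimpleGraph.hasse B = (SimpleGraph.hasse P).induce B := by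
  have key : ∀ x y : B, x ⋖ y ↔ (x : P) ⋖ (y : P) := by
    intro x y
    refine ⟨fun h => ⟨h.1, fun z hz hz' => ?_⟩, fun h => ⟨h.1, fun z hz hz' => h.2 hz hz'⟩⟩
    exact h.2 (c := ⟨z, hB.out x.2 y.2 ⟨hz.le, hz'.le⟩⟩) hz hz'
  ext x y
  simp [SimpleGraph.hasse_adj, key]

/-- A block of a poset `P` is a convex subposet `B` whose cover graph is a block of the cover
graph of `P`. The cover graph of the convex subposet `B` is identified with the subgraph of the
cover graph of `P` induced on `B`, see `hasse_eq_induce`. -/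
def IsBlock {P : Type*} [PartialOrder P] (B : Set P) : Prop :=
  B.OrdConnected ∧ IsGraphBlock ((⊤ : (SimpleGraph.hasse P).Subgraph).induce B)

end PosetBlocks

/-!
The upper bound is proved for *rooted* realizers: linear extensions `L₁, …, L_d, U, D` which
realize `P` and are such that, for a given root `r`, the elements before `r` in `U` are exactly those
below `r` in `P`, and the elements after `r` in `D` are exactly those above it. Choose a block `B`
containing `r`. The rest of `P` hangs from `B`: there is a retraction `π` onto `B` such that elements
of distinct fibres are comparable only through the points of `B` (`exists_isGate`; the reason is that
a path outside `B` joining two points of `B` would enlarge the block). By induction each fibre has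
a rooted realizer at its point of `B`, and these are combined (`IsGate.hasRootedRealizer`). For
`L₁, …, L_d`, replace the points of `B` in a realizer of `B` by their fibres. This leaves the pairs
`x`, `y` with `π x < π y` to be reversed, where `x` is not below `π x` or `y` is not above `π y`.
In `U`, the elements below their own gate come first, ordered along `B`, and are followed by the
others, ordered *against* `B`; this reverses all the pairs of the first kind (`IsGate.exists_upper`).
Dually, `D` reverses those of the second kind.

For the lower bound with `d ≥ 2`, hang a diamond `x_u < u, y_u < z_u` at every point `u` of the grid
`[n]^d`. The blocks are the grid and the diamonds. For points `p < q` of the grid a realizer has to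
reverse `d + 2` pairs (`criticalPair`): for each coordinate `j` it must put `x_u` above `z_w`, where
`u` and `w` arise from `p` and `q` by exchanging the `j`-th coordinates, and it must put `y_p` above
`q`, and `p` above `y_q`. By a product Ramsey theorem (`exists_monochromatic_grid`) there is
a `3 × ⋯ × 3` subgrid on which the linear extension that reverses a critical pair depends only on its
type, and then no linear extension can serve two types. For `d = 1`, the diamonds being too large,
a seven-element poset of dimension three is used whose cover graph is a tree (`Spider`).
-/

namespace PosetBlocks

/-! ### Linear extensions, realizers and dimension -/

/-- Szpilrajn's theorem for a partial order coarser than that of `P`. -/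
theorem exists_isLinearExtension {P : Type*} [PartialOrder P] (r : P → P → Prop)
    (hle : ∀ x y, x ≤ y → r x y) (hanti : ∀ x y, r x y → r y x → x = y)
    (htrans : ∀ x y z, r x y → r y z → r x z) :
    ∃ s : P → P → Prop, IsLinearExtension s ∧ ∀ x y, r x y → s x y := by
  have : IsPartialOrder P r :=
    { refl := fun x => hle x x le_rfl
      trans := htrans
      antisymm := hanti }
  obtain ⟨s, hs, hrs⟩ := extend_partialOrder r
  exact ⟨s, ⟨fun x => hs.refl x, fun x y => hs.antisymm x y, fun x y z => hs.trans x y z,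
    fun x y => hs.total x y, fun x y h => hrs x y (hle x y h)⟩, fun x y h => hrs x y h⟩

theorem IsLinearExtension.comap {P Q : Type*} [PartialOrder P] [PartialOrder Q]
    {r : P → P → Prop} (hr : IsLinearExtension r) {f : Q → P} (hf : Function.Injective f)
    (hmono : Monotone f) : IsLinearExtension fun x y => r (f x) (f y) where
  refl x := hr.refl _
  antisymm x y h h' := hf (hr.antisymm _ _ h h')
  trans x y z := hr.trans _ _ _
  total x y := hr.total _ _
  extends_le x y h := hr.extends_le _ _ (hmono h)

/-- Reversing a linear extension of the dual of `P` gives a linear extension of `P`. -/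
theorem IsLinearExtension.of_dual {P : Type*} [PartialOrder P] {r : Pᵒᵈ → Pᵒᵈ → Prop}
    (hr : IsLinearExtension r) :
    IsLinearExtension fun x y : P => r (OrderDual.toDual y) (OrderDual.toDual x) where
  refl x := hr.refl _
  antisymm x y h h' := OrderDual.toDual.injective (hr.antisymm _ _ h' h)
  trans x y z h h' := hr.trans _ _ _ h' h
  total x y := hr.total _ _
  extends_le x y h := hr.extends_le _ _ h

theorem IsLinearExtension.of_not {P : Type*} [PartialOrder P] {r : P → P → Prop}
    (hr : IsLinearExtension r) {x y : P} (h : ¬ r x y) : r y x :=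
  (hr.total x y).resolve_left h

/-- `P` has a realizer consisting of `k` linear extensions (repetitions allowed). -/
def HasRealizer (P : Type*) [PartialOrder P] (k : ℕ) : Prop :=
  ∃ L : Fin k → P → P → Prop, IsRealizer L

theorem HasRealizer.mono {P : Type*} [PartialOrder P] {k m : ℕ} (h : HasRealizer P k)
    (hk : 0 < k) (hkm : k ≤ m) : HasRealizer P m := by
  obtain ⟨L, hL, hLe⟩ := h
  refine ⟨fun i => L (if h : (i : ℕ) < k then ⟨i, h⟩ else ⟨0, hk⟩), fun i => hL _, fun x y =>
    ⟨fun hxy i => (hL _).extends_le x y hxy, fun hxy => (hLe x y).2 fun i => ?_⟩⟩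
  simpa using hxy ⟨i, i.2.trans_le hkm⟩

theorem HasRealizer.comap {P Q : Type*} [PartialOrder P] [PartialOrder Q] {k : ℕ}
    (h : HasRealizer P k) (f : Q ↪o P) : HasRealizer Q k := by
  obtain ⟨L, hL, hLe⟩ := h
  exact ⟨fun i x y => L i (f x) (f y), fun i => (hL i).comap f.injective f.monotone,
    fun x y => by rw [← f.le_iff_le, hLe]⟩

/-- Partial orders containing the order of `P` may be completed to a realizer as soon as every
pair with `¬ x ≤ y` is reversed in one of them. -/
theorem HasRealizer.of_reversing {P : Type*} [PartialOrder P] {k : ℕ}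
    (r : Fin k → P → P → Prop) (hle : ∀ i x y, x ≤ y → r i x y)
    (hanti : ∀ i x y, r i x y → r i y x → x = y)
    (htrans : ∀ i x y z, r i x y → r i y z → r i x z)
    (hrev : ∀ x y, ¬ x ≤ y → ∃ i, r i y x) : HasRealizer P k := by
  choose s hs hrs using fun i => exists_isLinearExtension (r i) (hle i) (hanti i) (htrans i)
  refine ⟨s, hs, fun x y => ⟨fun h i => (hs i).extends_le x y h, fun h => ?_⟩⟩
  by_contra hxy
  obtain ⟨i, hi⟩ := hrev x y hxy
  exact hxy ((hs i).antisymm x y (h i) (hrs i y x hi)).le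

theorem dim_le_iff {P : Type*} [PartialOrder P] {d : ℕ} (hd : 0 < d) :
    dim P ≤ (d : ℕ∞) ↔ HasRealizer P d := by
  constructor
  · intro h
    have hne : {n : ℕ∞ | ∃ k : ℕ, n = k ∧ 0 < k ∧ ∃ L : Fin k → P → P → Prop,
        IsRealizer L}.Nonempty := by
      by_contra hne
      rw [Set.not_nonempty_iff_eq_empty] at hne
      rw [dim, hne, sInf_empty] at h
      exact absurd h (by simp)
    obtain ⟨k, hk, hk0, hL⟩ := csInf_mem hne
    change dim P = k at hk
    rw [hk] at h
    exact HasRealizer.mono hL hk0 (by exact_mod_cast h)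
  · intro h
    exact sInf_le ⟨d, rfl, hd, h⟩

theorem le_dim {P : Type*} [PartialOrder P] {d : ℕ}
    (h : ∀ k : ℕ, HasRealizer P k → d ≤ k) : (d : ℕ∞) ≤ dim P := by
  refine le_sInf ?_
  rintro n ⟨k, rfl, -, hL⟩
  exact_mod_cast h k hL

/-- `R` restricts to a linear extension of each fibre of `κ`; what it does across different fibres
is irrelevant. -/
structure IsFibreExtension {P K : Type*} [PartialOrder P] (κ : P → K) (R : P → P → Prop) :
    Prop where
  antisymm : ∀ x y, κ x = κ y → R x y → R y x → x = y
  trans : ∀ x y z, κ x = κ y → κ y = κ z → R x y → R y z → R x z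
  total : ∀ x y, κ x = κ y → R x y ∨ R y x
  extends_le : ∀ x y, κ x = κ y → x ≤ y → R x y

theorem IsFibreExtension.of_finer {P K K' : Type*} [PartialOrder P] {κ : P → K} {κ' : P → K'}
    {R : P → P → Prop} (hR : IsFibreExtension κ R) (h : ∀ x y, κ' x = κ' y → κ x = κ y) :
    IsFibreExtension κ' R where
  antisymm x y e := hR.antisymm x y (h x y e)
  trans x y z e e' := hR.trans x y z (h x y e) (h y z e')
  total x y e := hR.total x y (h x y e)
  extends_le x y e := hR.extends_le x y (h x y e)

/-- Linear extensions of the fibres of `κ`, taken as subposets, assemble to a single relation. -/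
theorem isFibreExtension_of_forall {P K : Type*} [PartialOrder P] {κ : P → K}
    {S : ∀ u : K, {x // κ x = u} → {x // κ x = u} → Prop} (hS : ∀ u, IsLinearExtension (S u)) :
    IsFibreExtension κ fun x y => ∃ u, ∃ (hx : κ x = u) (hy : κ y = u), S u ⟨x, hx⟩ ⟨y, hy⟩ where
  antisymm := by
    rintro x y - ⟨u, rfl, hy, h⟩ ⟨v, hy', rfl, h'⟩
    exact congrArg Subtype.val ((hS _).antisymm _ _ h h')
  trans := by
    rintro x y z - - ⟨u, hx, rfl, h⟩ ⟨v, rfl, hz, h'⟩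
    exact ⟨_, hx, hz, (hS _).trans _ _ _ h h'⟩
  total x y e := ((hS (κ y)).total ⟨x, e⟩ ⟨y, rfl⟩).imp (fun h => ⟨_, e, rfl, h⟩)
    (fun h => ⟨_, rfl, e, h⟩)
  extends_le x y e h := ⟨_, e, rfl, (hS (κ y)).extends_le _ _ h⟩

/-- The lexicographic order determined by a map `κ : P → K`, a relation `M` on `K`, and
a relation `R` that orders each fibre of `κ`. -/
def Lex {P K : Type*} (κ : P → K) (M : K → K → Prop) (R : P → P → Prop) (x y : P) : Prop :=
  (κ x ≠ κ y ∧ M (κ x) (κ y)) ∨ (κ x = κ y ∧ R x y)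

theorem lex_iff_of_ne {P K : Type*} {κ : P → K} {M : K → K → Prop} {R : P → P → Prop} {x y : P}
    (h : κ x ≠ κ y) : Lex κ M R x y ↔ M (κ x) (κ y) := by
  simp [Lex, h]

theorem lex_iff_of_eq {P K : Type*} {κ : P → K} {M : K → K → Prop} {R : P → P → Prop} {x y : P}
    (h : κ x = κ y) : Lex κ M R x y ↔ R x y := by
  simp [Lex, h]

theorem isLinearExtension_lex {P K : Type*} [PartialOrder P] {κ : P → K} {M : K → K → Prop}
    {R : P → P → Prop} (hR : IsFibreExtension κ R)
    (hanti : ∀ u v, M u v → M v u → u = v) (htrans : ∀ u v w, M u v → M v w → M u w)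
    (htotal : ∀ u v, M u v ∨ M v u) (hle : ∀ x y, x ≤ y → κ x ≠ κ y → M (κ x) (κ y)) :
    IsLinearExtension (Lex κ M R) where
  refl x := (lex_iff_of_eq rfl).2 (hR.extends_le x x rfl le_rfl)
  antisymm x y h h' := by
    by_cases hxy : κ x = κ y
    · exact hR.antisymm x y hxy ((lex_iff_of_eq hxy).1 h) ((lex_iff_of_eq hxy.symm).1 h')
    · rw [lex_iff_of_ne hxy] at h
      rw [lex_iff_of_ne (Ne.symm hxy)] at h'
      exact absurd (hanti _ _ h h') hxy
  trans x y z h h' := by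
    by_cases hxy : κ x = κ y
    · by_cases hyz : κ y = κ z
      · rw [lex_iff_of_eq hxy] at h
        rw [lex_iff_of_eq hyz] at h'
        exact (lex_iff_of_eq (hxy.trans hyz)).2 (hR.trans x y z hxy hyz h h')
      · rw [lex_iff_of_ne hyz] at h'
        exact (lex_iff_of_ne (hxy ▸ hyz)).2 (hxy ▸ h')
    · rw [lex_iff_of_ne hxy] at h
      by_cases hyz : κ y = κ z
      · exact (lex_iff_of_ne (hyz ▸ hxy)).2 (hyz ▸ h)
      · rw [lex_iff_of_ne hyz] at h'
        have hxz : κ x ≠ κ z := fun e => hxy (hanti _ _ h (e ▸ h'))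
        exact (lex_iff_of_ne hxz).2 (htrans _ _ _ h h')
  total x y := by
    by_cases hxy : κ x = κ y
    · rw [lex_iff_of_eq hxy, lex_iff_of_eq hxy.symm]
      exact hR.total x y hxy
    · rw [lex_iff_of_ne hxy, lex_iff_of_ne (Ne.symm hxy)]
      exact htotal _ _
  extends_le x y h := by
    by_cases hxy : κ x = κ y
    · exact (lex_iff_of_eq hxy).2 (hR.extends_le x y hxy h)
    · exact (lex_iff_of_ne hxy).2 (hle x y h hxy)

/-! ### Gluing along a block -/

/-- A realizer `L₁, …, L_d, U, D` of `P` in which `U` puts below `r` only the elements below `r`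
in `P`, and `D` puts above `r` only the elements above `r` in `P`. -/
def HasRootedRealizer (P : Type*) [PartialOrder P] (d : ℕ) (r : P) : Prop :=
  ∃ (L : Fin d → P → P → Prop) (U D : P → P → Prop),
    (∀ i, IsLinearExtension (L i)) ∧ IsLinearExtension U ∧ IsLinearExtension D ∧
    (∀ x y, (∀ i, L i x y) → U x y → D x y → x ≤ y) ∧
    (∀ z, U z r → z ≤ r) ∧ (∀ z, D r z → r ≤ z)

theorem HasRootedRealizer.congr {P : Type*} [PartialOrder P] {p q : P → Prop} {d : ℕ} {r : P}
    {hp : p r} (h : HasRootedRealizer {x // p x} d ⟨r, hp⟩) (hpq : p = q) (hq : q r) :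
    HasRootedRealizer {x // q x} d ⟨r, hq⟩ := by
  subst hpq
  exact h

theorem HasRootedRealizer.hasRealizer {P : Type*} [PartialOrder P] {d : ℕ} {r : P}
    (h : HasRootedRealizer P d r) : HasRealizer P (d + 2) := by
  obtain ⟨L, U, D, hL, hU, hD, h, -, -⟩ := h
  refine ⟨Fin.cons U (Fin.cons D L), ?_, ?_⟩
  · simpa [Fin.forall_fin_succ] using ⟨hU, hD, hL⟩
  · intro x y
    simp only [Fin.forall_fin_succ, Fin.cons_zero, Fin.cons_succ]
    exact ⟨fun hxy => ⟨hU.extends_le _ _ hxy, hD.extends_le _ _ hxy,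
      fun i => (hL i).extends_le _ _ hxy⟩, fun ⟨a, b, c⟩ => h x y c a b⟩

/-- `π` retracts `P` onto `B` in such a way that distinct fibres are comparable only through
their gates: the fibre over `u` hangs from `B` at `u`. -/
structure IsGate {P : Type*} [PartialOrder P] (B : Set P) (π : P → P) : Prop where
  mem : ∀ x, π x ∈ B
  map_mem : ∀ u ∈ B, π u = u
  le : ∀ x y, x ≤ y → π x = π y ∨ (x ≤ π x ∧ π x ≤ π y ∧ π y ≤ y)

theorem IsGate.map_map {P : Type*} [PartialOrder P] {B : Set P} {π : P → P} (hπ : IsGate B π)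
    (x : P) : π (π x) = π x :=
  hπ.map_mem _ (hπ.mem x)

theorem IsGate.dual {P : Type*} [PartialOrder P] {B : Set P} {π : P → P} (hπ : IsGate B π) :
    IsGate (OrderDual.ofDual ⁻¹' B) (OrderDual.toDual ∘ π ∘ OrderDual.ofDual) where
  mem x := hπ.mem _
  map_mem u hu := hπ.map_mem _ hu
  le x y h := by
    rcases hπ.le (OrderDual.ofDual y) (OrderDual.ofDual x) h with h | ⟨h1, h2, h3⟩
    · exact Or.inl h.symm
    · exact Or.inr ⟨h3, h2, h1⟩

/-- The order in which the keys `(high?, gate)` are arranged: the low elements come first, ordered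
along `N`, and are followed by the high elements, ordered against `N`. -/
def KeyLE {P : Type*} (N : P → P → Prop) (a b : Prop × P) : Prop :=
  (¬ a.1 ∧ b.1) ∨ (¬ a.1 ∧ ¬ b.1 ∧ N a.2 b.2) ∨ (a.1 ∧ b.1 ∧ N b.2 a.2)

/-- Given linear extensions of the fibres of a gate map, in each of which only the elements below
the gate come before it, there is a linear extension `U` of `P` inducing them, in which `x` exceeds
all of the fibre over `w` whenever `x` is not below its gate `π x` and `π x < w`. -/
theorem IsGate.exists_upper {P : Type*} [PartialOrder P] {B : Set P} {π : P → P}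
    (hπ : IsGate B π) {R : P → P → Prop} (hR : IsFibreExtension π R)
    (hRr : ∀ z, R z (π z) → z ≤ π z) {r : P} (hr : r ∈ B) :
    ∃ U : P → P → Prop, IsLinearExtension U ∧ (∀ x y, π x = π y → U x y → R x y) ∧
      (∀ x y, U x y → π x ≠ π y → π x ≤ π y → x ≤ π x) ∧ ∀ z, U z r → z ≤ r := by
  -- `N` starts with the elements below `r`, which settles the condition at the root.
  obtain ⟨N, hN, hNr⟩ := exists_isLinearExtension
    (fun x y : P => x ≤ y ∨ (x ≤ r ∧ ¬ y ≤ r)) (fun x y h => Or.inl h)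
    (by
      rintro x y (h | h) (h' | h')
      · exact le_antisymm h h'
      · exact absurd (h.trans h'.1) h'.2
      · exact absurd (h'.trans h.1) h.2
      · exact absurd h.1 h'.2)
    (by
      rintro x y z (h | h) (h' | h')
      · exact Or.inl (h.trans h')
      · exact Or.inr ⟨h.trans h'.1, h'.2⟩
      · exact Or.inr ⟨h.1, fun hz => h.2 (h'.trans hz)⟩
      · exact Or.inr ⟨h.1, h'.2⟩)
  -- An element is low when it is below its gate, and high otherwise.
  let κ : P → Prop × P := fun x => (¬ x ≤ π x, π x)
  have hκπ : ∀ x y, κ x = κ y → π x = π y := fun x y h => congrArg Prod.snd h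
  have hU : IsLinearExtension (Lex κ (KeyLE N) R) := by
    refine isLinearExtension_lex (hR.of_finer hκπ) ?_ ?_ ?_ ?_
    · rintro ⟨a, u⟩ ⟨b, v⟩ h h'
      have h1 := hN.antisymm u v
      simp only [KeyLE] at h h'
      by_cases ha : a <;> by_cases hb : b <;> simp_all
    · rintro ⟨a, u⟩ ⟨b, v⟩ ⟨c, w⟩ h h'
      have h1 := hN.trans u v w
      have h2 := hN.trans w v u
      simp only [KeyLE] at *
      tauto
    · rintro ⟨a, u⟩ ⟨b, v⟩
      have h1 := hN.total u v
      simp only [KeyLE]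
      tauto
    · intro x y hxy hne
      simp only [κ, KeyLE, not_not]
      rcases hπ.le x y hxy with h | ⟨h1, h2, h3⟩
      · have hx : y ≤ π y → x ≤ π x := fun hy => h ▸ hxy.trans hy
        have h1 := hN.refl (π y)
        rw [h] at hx ⊢
        tauto
      · have := hN.extends_le _ _ h2
        tauto
  have hUR : ∀ x y, π x = π y → Lex κ (KeyLE N) R x y → R x y := by
    intro x y hxy h
    by_cases hk : κ x = κ y
    · exact (lex_iff_of_eq hk).1 h
    · rw [lex_iff_of_ne hk] at h
      have hx : x ≤ π x ∧ ¬ y ≤ π y := by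
        simp only [κ, Prod.mk.injEq, hxy, and_true, eq_iff_iff, not_iff_not] at hk
        simp only [κ, KeyLE, not_not, hxy] at h ⊢
        tauto
      -- Otherwise `y` precedes `x`, and hence the common gate, in the order of the fibre.
      refine (hR.total x y hxy).resolve_right fun hyx => hx.2 (hRr y ?_)
      have hxg : R x (π x) := hR.extends_le x _ (hπ.map_map x).symm hx.1
      exact hxy ▸ hR.trans y x (π x) hxy.symm (hπ.map_map x).symm hyx hxg
  refine ⟨_, hU, hUR, ?_, ?_⟩
  · intro x y h hne hle
    rw [lex_iff_of_ne (fun e => hne (hκπ x y e))] at h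
    by_contra hx
    have hyx : N (π y) (π x) := by
      simp only [κ, KeyLE] at h
      tauto
    exact hne (hN.antisymm _ _ (hN.extends_le _ _ hle) hyx)
  · intro z hz
    have hrr := hπ.map_mem r hr
    by_cases h : π z = r
    · have := hUR z r (h.trans hrr.symm) hz
      rw [← h] at this ⊢
      exact hRr z this
    · rw [lex_iff_of_ne (fun e => h ((hκπ z r e).trans hrr))] at hz
      have hz' : z ≤ π z ∧ N (π z) r := by
        simp only [κ, KeyLE, hrr, le_refl] at hz
        tauto
      by_contra hzr
      have hzr' : ¬ π z ≤ r := fun e => hzr (hz'.1.trans e)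
      exact h (hN.antisymm _ _ hz'.2 (hNr _ _ (Or.inr ⟨le_rfl, hzr'⟩)))

/-- The dual of `IsGate.exists_upper`. -/
theorem IsGate.exists_lower {P : Type*} [PartialOrder P] {B : Set P} {π : P → P}
    (hπ : IsGate B π) {R : P → P → Prop} (hR : IsFibreExtension π R)
    (hRr : ∀ z, R (π z) z → π z ≤ z) {r : P} (hr : r ∈ B) :
    ∃ D : P → P → Prop, IsLinearExtension D ∧ (∀ x y, π x = π y → D x y → R x y) ∧
      (∀ x y, D x y → π x ≠ π y → π x ≤ π y → π y ≤ y) ∧ ∀ z, D r z → r ≤ z := by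
  have hR' : IsFibreExtension (OrderDual.toDual ∘ π ∘ OrderDual.ofDual)
      fun x y : Pᵒᵈ => R (OrderDual.ofDual y) (OrderDual.ofDual x) :=
    { antisymm := fun x y e h h' => hR.antisymm _ _ e h' h
      trans := fun x y z e e' h h' => hR.trans _ _ _ e'.symm e.symm h' h
      total := fun x y e => hR.total _ _ e.symm
      extends_le := fun x y e h => hR.extends_le _ _ e.symm h }
  obtain ⟨U, hU, h1, h2, h3⟩ := hπ.dual.exists_upper hR' (fun z => hRr _)
    (r := OrderDual.toDual r) hr
  exact ⟨_, hU.of_dual, fun x y e h => h1 _ _ e.symm h,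
    fun x y h hne hle => h2 _ _ h (Ne.symm hne) hle, fun z hz => h3 _ hz⟩

/-- If `B` has a realizer of size `d` and each fibre of a gate map onto `B` has a rooted realizer
at its gate, then `P` has a rooted realizer at any point of `B`: the first `d` linear extensions
replace each `u` in a realizer of `B` by the fibre over `u`. -/
theorem IsGate.hasRootedRealizer {P : Type*} [PartialOrder P] {B : Set P} {π : P → P}
    (hπ : IsGate B π) {d : ℕ} (hB : HasRealizer B d)
    (hT : ∀ (u : P) (hu : π u = u), HasRootedRealizer {x // π x = u} d ⟨u, hu⟩)
    {r : P} (hr : r ∈ B) : HasRootedRealizer P d r := by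
  obtain ⟨M, hM, hMle⟩ := hB
  let κ : P → B := fun x => ⟨π x, hπ.mem x⟩
  have hκ : ∀ {x y}, κ x = κ y ↔ π x = π y := Subtype.ext_iff
  have hT' : ∀ u : B, HasRootedRealizer {x // κ x = u} d ⟨u, Subtype.ext (hπ.map_mem u u.2)⟩ :=
    fun u => (hT u (hπ.map_mem u u.2)).congr
      (funext fun x => propext ⟨fun h => Subtype.ext h, congrArg Subtype.val⟩) _
  choose L U D hL hU hD hle hUr hDr using hT'
  obtain ⟨U', hU', hU1, hU2, hU3⟩ := hπ.exists_upper
    ((isFibreExtension_of_forall hU).of_finer fun _ _ => hκ.2) (by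
      rintro z ⟨_, rfl, hy, h⟩
      exact hUr _ _ h) hr
  obtain ⟨D', hD', hD1, hD2, hD3⟩ := hπ.exists_lower
    ((isFibreExtension_of_forall hD).of_finer fun _ _ => hκ.2) (by
      rintro z ⟨_, hx, rfl, h⟩
      exact hDr _ _ h) hr
  refine ⟨fun i => Lex κ (M i) (fun x y => ∃ u, ∃ (hx : κ x = u) (hy : κ y = u),
    L u i ⟨x, hx⟩ ⟨y, hy⟩), U', D', fun i => ?_, hU', hD', ?_, hU3, hD3⟩
  · refine isLinearExtension_lex (isFibreExtension_of_forall fun u => hL u i)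
      (hM i).antisymm (hM i).trans (hM i).total fun x y h hne => (hM i).extends_le _ _ ?_
    exact ((hπ.le x y h).resolve_left fun e => hne (hκ.2 e)).2.1
  · intro x y hl hu hd
    by_cases hxy : κ x = κ y
    · have hpi := hκ.1 hxy
      have key : ∀ {R : ∀ u : B, {x // κ x = u} → {x // κ x = u} → Prop},
          (∃ u, ∃ (hx : κ x = u) (hy : κ y = u), R u ⟨x, hx⟩ ⟨y, hy⟩) →
            R (κ y) ⟨x, hxy⟩ ⟨y, rfl⟩ := by
        rintro R ⟨_, _, rfl, h⟩
        exact h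
      exact hle (κ y) ⟨x, hxy⟩ ⟨y, rfl⟩ (fun i => key ((lex_iff_of_eq hxy).1 (hl i)))
        (key (hU1 x y hpi hu)) (key (hD1 x y hpi hd))
    · have h : κ x ≤ κ y := (hMle _ _).2 fun i => (lex_iff_of_ne hxy).1 (hl i)
      have hne : π x ≠ π y := fun e => hxy (hκ.2 e)
      exact (hU2 x y hu hne h).trans (le_trans h (hD2 x y hd hne h))

/-- An element comparable to no other one may be added to a rooted realizer, as the new root. -/
theorem hasRootedRealizer_of_isolated {P : Type*} [PartialOrder P] {d : ℕ} {r : P}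
    (h1 : ∀ x, x ≤ r → x = r) (h2 : ∀ x, r ≤ x → x = r) (h : HasRealizer {x // x ≠ r} (d + 2)) :
    HasRootedRealizer P d r := by
  obtain ⟨L, hL, hLe⟩ := h
  let bot : ({x // x ≠ r} → {x // x ≠ r} → Prop) → P → P → Prop := fun R x y =>
    x = r ∨ ∃ (hx : x ≠ r) (hy : y ≠ r), R ⟨x, hx⟩ ⟨y, hy⟩
  let top : ({x // x ≠ r} → {x // x ≠ r} → Prop) → P → P → Prop := fun R x y =>
    y = r ∨ ∃ (hx : x ≠ r) (hy : y ≠ r), R ⟨x, hx⟩ ⟨y, hy⟩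
  have hbot : ∀ R, IsLinearExtension R → IsLinearExtension (bot R) := by
    intro R hR
    refine ⟨fun x => ?_, ?_, ?_, fun x y => ?_, fun x y hxy => ?_⟩
    · by_cases hx : x = r
      · exact Or.inl hx
      · exact Or.inr ⟨hx, hx, hR.refl _⟩
    · rintro x y (rfl | ⟨hx, hy, h⟩) (rfl | ⟨hx', hy', h'⟩)
      · rfl
      · exact absurd rfl hy'
      · exact absurd rfl hy
      · exact congrArg Subtype.val (hR.antisymm _ _ h h')
    · rintro x y z (rfl | ⟨hx, hy, h⟩) (rfl | ⟨hx', hy', h'⟩)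
      · exact Or.inl rfl
      · exact Or.inl rfl
      · exact absurd rfl hy
      · exact Or.inr ⟨hx, hy', hR.trans _ _ _ h h'⟩
    · by_cases hx : x = r
      · exact Or.inl (Or.inl hx)
      by_cases hy : y = r
      · exact Or.inr (Or.inl hy)
      · exact (hR.total ⟨x, hx⟩ ⟨y, hy⟩).imp (fun h => Or.inr ⟨hx, hy, h⟩)
          (fun h => Or.inr ⟨hy, hx, h⟩)
    · by_cases hx : x = r
      · exact Or.inl hx
      · exact Or.inr ⟨hx, fun hy => hx (h1 x (hy ▸ hxy)), hR.extends_le _ _ hxy⟩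
  have htop : ∀ R, IsLinearExtension R → IsLinearExtension (top R) := by
    intro R hR
    refine ⟨fun x => ?_, ?_, ?_, fun x y => ?_, fun x y hxy => ?_⟩
    · by_cases hx : x = r
      · exact Or.inl hx
      · exact Or.inr ⟨hx, hx, hR.refl _⟩
    · rintro x y (rfl | ⟨hx, hy, h⟩) (rfl | ⟨hx', hy', h'⟩)
      · rfl
      · exact absurd rfl hx'
      · exact absurd rfl hx
      · exact congrArg Subtype.val (hR.antisymm _ _ h h')
    · rintro x y z (rfl | ⟨hx, hy, h⟩) (rfl | ⟨hx', hy', h'⟩)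
      · exact Or.inl rfl
      · exact absurd rfl hx'
      · exact Or.inl rfl
      · exact Or.inr ⟨hx, hy', hR.trans _ _ _ h h'⟩
    · by_cases hx : x = r
      · exact Or.inr (Or.inl hx)
      by_cases hy : y = r
      · exact Or.inl (Or.inl hy)
      · exact (hR.total ⟨x, hx⟩ ⟨y, hy⟩).imp (fun h => Or.inr ⟨hx, hy, h⟩)
          (fun h => Or.inr ⟨hy, hx, h⟩)
    · by_cases hy : y = r
      · exact Or.inl hy
      · exact Or.inr ⟨fun hx => hy (h2 y (hx ▸ hxy)), hy, hR.extends_le _ _ hxy⟩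
  -- As `r` comes first in `U` and last in `D`, both conditions at the root are trivial.
  refine ⟨fun i => bot (L i.succ.succ), bot (L 0), top (L 1), fun i => hbot _ (hL _),
    hbot _ (hL _), htop _ (hL _), ?_, ?_, ?_⟩
  · rintro x y hl (rfl | ⟨hx, hy, hu⟩) (rfl | ⟨hx', hy', hd⟩)
    · rfl
    · exact absurd rfl hx'
    · exact absurd rfl hy
    · refine (hLe ⟨x, hx⟩ ⟨y, hy⟩).2 ?_
      rw [Fin.forall_fin_succ, Fin.forall_fin_succ]
      refine ⟨hu, hd, fun i => ?_⟩
      rcases hl i with h | ⟨_, _, h⟩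
      · exact absurd h hx
      · exact h
  · rintro z (rfl | ⟨_, h, _⟩)
    · exact le_rfl
    · exact absurd rfl h
  · rintro z (rfl | ⟨h, _, _⟩)
    · exact le_rfl
    · exact absurd rfl h

/-! ### Nonseparable sets of vertices -/

section Graph

/-- The vertices `x` and `y` are joined by a walk of `G` inside `S` (or are equal). -/
def Joined {V : Type*} (G : SimpleGraph V) (S : Set V) : V → V → Prop :=
  Relation.ReflTransGen fun a b => G.Adj a b ∧ a ∈ S ∧ b ∈ S

/-- The set `S` of vertices of `G` is connected; the empty set is admitted. -/
def ConnOn {V : Type*} (G : SimpleGraph V) (S : Set V) : Prop :=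
  ∀ x ∈ S, ∀ y ∈ S, Joined G S x y

/-- The set `S` of vertices induces a nonseparable subgraph of `G`. -/
def NonsepOn {V : Type*} (G : SimpleGraph V) (S : Set V) : Prop :=
  S.Nonempty ∧ ConnOn G S ∧ ∀ v, ConnOn G (S \ {v})

variable {V : Type*} {G : SimpleGraph V} {S T : Set V}

theorem Joined.symm {x y : V} (h : Joined G S x y) : Joined G S y x := by
  induction h with
  | refl => exact Relation.ReflTransGen.refl
  | tail _ h ih => exact Relation.ReflTransGen.head ⟨h.1.symm, h.2.2, h.2.1⟩ ih

theorem Joined.mono {x y : V} (h : Joined G S x y) (hST : S ⊆ T) : Joined G T x y :=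
  Relation.ReflTransGen.mono (fun _ _ h => ⟨h.1, hST h.2.1, hST h.2.2⟩) _ _ h

theorem Joined.trans {x y z : V} (h : Joined G S x y) (h' : Joined G S y z) : Joined G S x z :=
  Relation.ReflTransGen.trans h h'

theorem joined_of_adj {x y : V} (h : G.Adj x y) (hx : x ∈ S) (hy : y ∈ S) : Joined G S x y :=
  Relation.ReflTransGen.single ⟨h, hx, hy⟩

theorem ConnOn.map {W : Type*} {K : SimpleGraph W} {A : Set W} (h : ConnOn K A) (f : W → V)
    (hf : ∀ a b, K.Adj a b → G.Adj (f a) (f b)) : ConnOn G (f '' A) := by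
  rintro _ ⟨x, hx, rfl⟩ _ ⟨y, hy, rfl⟩
  have key : ∀ z, Joined K A x z → Joined G (f '' A) (f x) (f z) := by
    intro z hz
    induction hz with
    | refl => exact Relation.ReflTransGen.refl
    | tail _ hbc ih =>
      exact Relation.ReflTransGen.tail ih
        ⟨hf _ _ hbc.1, ⟨_, hbc.2.1, rfl⟩, ⟨_, hbc.2.2, rfl⟩⟩
  exact key y (h x hx y hy)

theorem connOn_induce_iff {A : Set S} : ConnOn (G.induce S) A ↔ ConnOn G (Subtype.val '' A) := by
  refine ⟨fun h => h.map Subtype.val fun a b hab => hab, fun h x hx y hy => ?_⟩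
  have key : ∀ z, Joined G (Subtype.val '' A) x z → ∀ hz : z ∈ S,
      Joined (G.induce S) A x ⟨z, hz⟩ := by
    intro z hz
    induction hz with
    | refl => exact fun _ => Relation.ReflTransGen.refl
    | tail _ hbc ih =>
      obtain ⟨hadj, ⟨b, hb, rfl⟩, ⟨c, hc, rfl⟩⟩ := hbc
      exact fun _ => Relation.ReflTransGen.tail (ih b.2) ⟨hadj, hb, hc⟩
  exact key y (h x ⟨x, hx, rfl⟩ y ⟨y, hy, rfl⟩) y.2

theorem preconnected_iff_connOn_univ : G.Preconnected ↔ ConnOn G Set.univ := by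
  simp [SimpleGraph.Preconnected, ConnOn, Joined, SimpleGraph.reachable_iff_reflTransGen]

theorem preconnected_induce_iff : (G.induce S).Preconnected ↔ ConnOn G S := by
  rw [preconnected_iff_connOn_univ, connOn_induce_iff, Set.image_univ, Subtype.range_coe]

theorem isNonseparable_induce_iff : IsNonseparable (G.induce S) ↔ NonsepOn G S := by
  have hv : ∀ v : S, Subtype.val '' ({v}ᶜ : Set S) = S \ {(v : V)} := by
    intro v
    ext x
    simp only [Set.mem_image, Set.mem_compl_iff, Set.mem_singleton_iff, Subtype.exists,
      Set.mem_sdiff, Subtype.ext_iff]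
    exact ⟨fun ⟨a, ha, h, e⟩ => e ▸ ⟨ha, h⟩, fun ⟨ha, h⟩ => ⟨x, ha, h, rfl⟩⟩
  rw [IsNonseparable, SimpleGraph.connected_iff, preconnected_induce_iff, NonsepOn,
    ← Set.nonempty_coe_sort, and_comm (a := ConnOn G S), and_assoc]
  refine and_congr_right fun _ => and_congr_right fun hS => ?_
  simp only [preconnected_induce_iff, connOn_induce_iff, hv]
  refine ⟨fun h v => ?_, fun h v => h v⟩
  by_cases hvS : v ∈ S
  · exact h ⟨v, hvS⟩
  · rwa [Set.sdiff_singleton_eq_self hvS]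

theorem IsNonseparable.mono {G' : SimpleGraph V} (h : IsNonseparable G) (hle : G ≤ G') :
    IsNonseparable G' :=
  ⟨h.1.mono hle, fun v => (h.2 v).mono fun _ _ hab => hle hab⟩

theorem isNonseparable_coe_induce_iff :
    IsNonseparable ((⊤ : G.Subgraph).induce S).coe ↔ NonsepOn G S :=
  ⟨fun h => isNonseparable_induce_iff.1
      (IsNonseparable.mono (V := S) h fun _ _ hab => hab.2.2),
    fun h => IsNonseparable.mono (V := S) (isNonseparable_induce_iff.2 h)
      fun a b hab => ⟨a.2, b.2, hab⟩⟩

theorem NonsepOn.image {A : Set S} (h : NonsepOn (G.induce S) A) :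
    NonsepOn G (Subtype.val '' A) := by
  refine ⟨h.1.image _, connOn_induce_iff.1 h.2.1, fun v => ?_⟩
  by_cases hv : v ∈ S
  · have := connOn_induce_iff.1 (h.2.2 ⟨v, hv⟩)
    rwa [Set.image_sdiff Subtype.val_injective, Set.image_singleton] at this
  · rw [Set.sdiff_singleton_eq_self]
    · exact connOn_induce_iff.1 h.2.1
    · rintro ⟨x, -, rfl⟩
      exact hv x.2

theorem nonsepOn_pair {r s : V} (h : G.Adj r s) : NonsepOn G {r, s} := by
  refine ⟨⟨r, by simp⟩, ?_, fun v => ?_⟩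
  · rintro x (rfl | rfl) y (rfl | rfl)
    · exact Relation.ReflTransGen.refl
    · exact joined_of_adj h (by simp) (by simp)
    · exact joined_of_adj h.symm (by simp) (by simp)
    · exact Relation.ReflTransGen.refl
  · rintro x ⟨rfl | rfl, hx⟩ y ⟨rfl | rfl, hy⟩
    · exact Relation.ReflTransGen.refl
    · exact joined_of_adj h ⟨by simp, hx⟩ ⟨by simp, hy⟩
    · exact joined_of_adj h.symm ⟨by simp, hx⟩ ⟨by simp, hy⟩
    · exact Relation.ReflTransGen.refl

/-- If the edges leaving `T` all leave it from `v`, then a nonseparable set either is contained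
in `T` or meets `T` at most in `v`. -/
theorem NonsepOn.subset_or {v : V} (hS : NonsepOn G S)
    (hT : ∀ a b, G.Adj a b → a ∈ T → b ∉ T → a = v) : S ⊆ T ∨ ∀ x ∈ S, x ∈ T → x = v := by
  by_contra! h
  obtain ⟨h1, a, haS, haT, hav⟩ := h
  obtain ⟨b, hbS, hbT⟩ := Set.not_subset.1 h1
  have hconn : ∃ S', a ∈ S' ∧ b ∈ S' ∧ (∀ x ∈ S', x ∈ T → x ≠ v) ∧ ConnOn G S' := by
    by_cases hvT : v ∈ T
    · exact ⟨S \ {v}, ⟨haS, hav⟩, ⟨hbS, fun e => hbT (e ▸ hvT)⟩, fun x hx _ => hx.2, hS.2.2 v⟩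
    · exact ⟨S, haS, hbS, fun x _ hx e => hvT (e ▸ hx), hS.2.1⟩
  obtain ⟨S', ha, hb, hSv, hS'⟩ := hconn
  have key : ∀ z, Joined G S' a z → z ∈ T := by
    intro z hz
    induction hz with
    | refl => exact haT
    | tail _ hbc ih =>
      by_contra hc
      exact hSv _ hbc.2.1 ih (hT _ _ hbc.1 ih hc)
  exact hbT (key b (hS' a ha b hb))

theorem joined_of_walk {a b : S} (p : (G.induce S).Walk a b)
    (hT : ∀ x ∈ p.support, (x : V) ∈ T) : Joined G T a b := by
  induction p with
  | nil => exact Relation.ReflTransGen.refl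
  | cons hadj p ih =>
    refine Relation.ReflTransGen.head ⟨hadj, hT _ (by simp), hT _ (by simp)⟩
      (ih fun x hx => hT x ?_)
    simp [hx]

/-- Adding an ear: if a path outside of `B` joins a neighbour of `u ∈ B` to a neighbour of another
vertex `w ∈ B`, then `B` together with the path is nonseparable. -/
theorem NonsepOn.union_path {B : Set V} (hB : NonsepOn G B) {u w : V} (hu : u ∈ B) (hw : w ∈ B)
    (huw : u ≠ w) {z z' : ↥Bᶜ} (p : (G.induce Bᶜ).Walk z z') (hp : p.IsPath) (hz : G.Adj z u)
    (hz' : G.Adj z' w) : NonsepOn G (B ∪ Subtype.val '' {x | x ∈ p.support}) := by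
  classical
  set C : Set V := Subtype.val '' {x | x ∈ p.support} with hC
  -- The case where nothing is removed and the case where a vertex is removed are treated together.
  have key : ∀ X : Set V, X.Subsingleton → ConnOn G (B \ X) → ConnOn G ((B ∪ C) \ X) := by
    intro X hX hBX
    have hsub : B \ X ⊆ (B ∪ C) \ X := Set.sdiff_subset_sdiff_left Set.subset_union_left
    have hlink : ∀ x ∈ (B ∪ C) \ X, ∃ y ∈ B \ X, Joined G ((B ∪ C) \ X) x y := by
      rintro x ⟨hx | ⟨x, hx, rfl⟩, hxX⟩
      · exact ⟨x, ⟨hx, hxX⟩, Relation.ReflTransGen.refl⟩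
      have hx : x ∈ p.support := hx
      by_cases h1 : u ∉ X ∧ ∀ y ∈ (p.takeUntil x hx).support, (y : V) ∉ X
      · have hmem : ∀ y ∈ (p.takeUntil x hx).support, (y : V) ∈ (B ∪ C) \ X := fun y hy =>
          ⟨Or.inr ⟨y, p.support_takeUntil_subset_support hx hy, rfl⟩, h1.2 y hy⟩
        refine ⟨u, ⟨hu, h1.1⟩, (joined_of_walk _ hmem).symm.trans (joined_of_adj hz ?_ ?_)⟩
        · exact hmem z (by simp)
        · exact ⟨Or.inl hu, h1.1⟩
      by_cases h2 : w ∉ X ∧ ∀ y ∈ (p.dropUntil x hx).support, (y : V) ∉ X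
      · have hmem : ∀ y ∈ (p.dropUntil x hx).support, (y : V) ∈ (B ∪ C) \ X := fun y hy =>
          ⟨Or.inr ⟨y, p.support_dropUntil_subset_support hx hy, rfl⟩, h2.2 y hy⟩
        refine ⟨w, ⟨hw, h2.1⟩, (joined_of_walk _ hmem).trans (joined_of_adj hz' ?_ ?_)⟩
        · exact hmem z' (by simp)
        · exact ⟨Or.inl hw, h2.1⟩
      -- The two arcs from `x` to `B` have only `x` in common, so `X` cannot meet both.
      exfalso
      have h1' : u ∈ X ∨ ∃ y ∈ (p.takeUntil x hx).support, (y : V) ∈ X := by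
        by_contra! h
        exact h1 h
      have h2' : w ∈ X ∨ ∃ y ∈ (p.dropUntil x hx).support, (y : V) ∈ X := by
        by_contra! h
        exact h2 h
      rcases h1' with h1' | ⟨y, hy, hyX⟩ <;> rcases h2' with h2' | ⟨y', hy', hyX'⟩
      · exact huw (hX h1' h2')
      · exact y'.2 (hX h1' hyX' ▸ hu)
      · exact y.2 (hX h2' hyX ▸ hw)
      · have hyy : y = y' := Subtype.ext (hX hyX hyX')
        subst hyy
        have hnd := hp.support_nodup
        rw [← p.take_spec hx, SimpleGraph.Walk.support_append, List.nodup_append] at hnd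
        rw [SimpleGraph.Walk.mem_support_iff] at hy'
        rcases hy' with rfl | hy'
        · exact hxX hyX
        · exact hnd.2.2 _ hy _ hy' rfl
    intro x hx y hy
    obtain ⟨x', hx', hxx⟩ := hlink x hx
    obtain ⟨y', hy', hyy⟩ := hlink y hy
    exact hxx.trans (((hBX x' hx' y' hy').mono hsub).trans hyy.symm)
  refine ⟨⟨u, Or.inl hu⟩, ?_, fun v => key _ Set.subsingleton_singleton (hB.2.2 v)⟩
  have := key ∅ Set.subsingleton_empty (by simpa using hB.2.1)
  simpa using this

/-- The gates of a maximal nonseparable set `B`: there is a retraction onto `B` that is constant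
along every edge not contained in `B`. -/
theorem exists_retraction {B : Set V} (hB : Maximal (NonsepOn G) B) :
    ∃ π : V → V, (∀ x, π x ∈ B) ∧ (∀ u ∈ B, π u = u) ∧
      ∀ a b, G.Adj a b → π a = π b ∨ (a ∈ B ∧ b ∈ B) := by
  classical
  obtain ⟨r, hr⟩ := hB.1.1
  let Att : V → V → Prop := fun x u => u ∈ B ∧ ∃ (z : V), z ∉ B ∧ Joined G Bᶜ x z ∧ G.Adj z u
  have huniq : ∀ x, x ∉ B → ∀ u w, Att x u → Att x w → u = w := by
    rintro x hx u w ⟨hu, z, hz, hxz, hzu⟩ ⟨hw, z', hz', hxz', hzw⟩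
    by_contra huw
    have hpre : (G.induce Bᶜ).Reachable ⟨z, hz⟩ ⟨z', hz'⟩ := by
      have key : ∀ y, Joined G Bᶜ z y → ∀ hy : y ∈ Bᶜ,
          (G.induce Bᶜ).Reachable ⟨z, hz⟩ ⟨y, hy⟩ := by
        intro y hy
        induction hy with
        | refl => exact fun _ => SimpleGraph.Reachable.refl _
        | tail _ hbc ih =>
          intro hc
          exact (ih hbc.2.1).trans (SimpleGraph.Adj.reachable (G := G.induce Bᶜ)
            (u := ⟨_, hbc.2.1⟩) (v := ⟨_, hc⟩) hbc.1)
      exact key z' (hxz.symm.trans hxz') hz'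
    obtain ⟨p, hp⟩ := hpre.exists_isPath
    have hmax := hB.2 (hB.1.union_path hu hw huw p hp hzu hzw) Set.subset_union_left
    exact hz (hmax (Or.inr ⟨⟨z, hz⟩, by simp, rfl⟩))
  have hatt : ∀ a b, G.Adj a b → a ∉ B → b ∉ B → ∀ u, Att a u → Att b u := by
    rintro a b hab ha hb u ⟨hu, z, hz, haz, hzu⟩
    exact ⟨hu, z, hz, (joined_of_adj hab.symm hb ha).trans haz, hzu⟩
  let π : V → V := fun x => if x ∈ B then x else if h : ∃ u, Att x u then h.choose else r
  have hπB : ∀ u ∈ B, π u = u := fun u hu => by simp [π, hu]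
  have hπ : ∀ x u, x ∉ B → Att x u → π x = u := by
    intro x u hx hu
    have h : ∃ u, Att x u := ⟨u, hu⟩
    have : π x = h.choose := by simp only [π, hx, if_false, dif_pos h]
    rw [this]
    exact huniq x hx _ _ h.choose_spec hu
  have hmix : ∀ a b, G.Adj a b → a ∉ B → b ∈ B → π a = π b := by
    intro a b hab ha hb
    rw [hπB b hb]
    exact hπ a b ha ⟨hb, a, ha, Relation.ReflTransGen.refl, hab⟩
  refine ⟨π, fun x => ?_, hπB, fun a b hab => ?_⟩
  · by_cases hx : x ∈ B
    · rwa [hπB x hx]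
    by_cases h : ∃ u, Att x u
    · obtain ⟨u, hu⟩ := h
      rw [hπ x u hx hu]
      exact hu.1
    · simpa [π, hx, h] using hr
  · by_cases ha : a ∈ B <;> by_cases hb : b ∈ B
    · exact Or.inr ⟨ha, hb⟩
    · exact Or.inl (hmix b a hab.symm hb ha).symm
    · exact Or.inl (hmix a b hab ha hb)
    · left
      by_cases h : ∃ u, Att a u
      · obtain ⟨u, hu⟩ := h
        rw [hπ a u ha hu, hπ b u hb (hatt a b hab ha hb u hu)]
      · have h' : ¬ ∃ u, Att b u := fun ⟨u, hu⟩ => h ⟨u, hatt b a hab.symm hb ha u hu⟩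
        simp only [π, ha, hb, if_false, dif_neg h, dif_neg h']

theorem exists_maximal_nonsepOn [Finite V] (hS : NonsepOn G S) :
    ∃ B, S ⊆ B ∧ Maximal (NonsepOn G) B :=
  (Set.toFinite {S | NonsepOn G S}).exists_le_maximal hS

end Graph

/-! ### Blocks of a poset and the upper bound -/

theorem IsBlock.nonsepOn {P : Type*} [PartialOrder P] {B : Set P} (h : IsBlock B) :
    NonsepOn (SimpleGraph.hasse P) B :=
  isNonseparable_coe_induce_iff.1 h.2.2.1

/-- A maximal nonseparable set of the cover graph comes with a gate map. -/
theorem exists_isGate {P : Type*} [PartialOrder P] [Finite P] {B : Set P}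
    (hB : Maximal (NonsepOn (SimpleGraph.hasse P)) B) : ∃ π : P → P, IsGate B π := by
  obtain ⟨π, h1, h2, h3⟩ := exists_retraction hB
  refine ⟨π, h1, h2, fun x y hxy => ?_⟩
  classical
  have := Fintype.ofFinite P
  let _ : LocallyFiniteOrder P := Fintype.toLocallyFiniteOrder
  -- Follow a chain of covers from `x` to `y`.
  induction le_iff_reflTransGen_covBy.1 hxy using Relation.ReflTransGen.head_induction_on with
  | refl => exact Or.inl rfl
  | @head x z hxz hzy ih =>
    have ih := ih (le_iff_reflTransGen_covBy.2 hzy)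
    rcases h3 x z (Or.inl hxz) with h | ⟨hx, hz⟩
    · rw [h]
      exact ih.imp_right fun ⟨i1, i2, i3⟩ => ⟨hxz.le.trans i1, i2, i3⟩
    · rw [h2 x hx]
      rw [h2 z hz] at ih
      rcases ih with h | ⟨-, i2, i3⟩
      · exact Or.inr ⟨le_rfl, h ▸ hxz.le, h ▸ le_iff_reflTransGen_covBy.2 hzy⟩
      · exact Or.inr ⟨le_rfl, hxz.le.trans i2, i3⟩

theorem IsGate.ordConnected {P : Type*} [PartialOrder P] {B : Set P} {π : P → P}
    (hπ : IsGate B π) : B.OrdConnected := by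
  refine ⟨fun x hx z hz y ⟨hxy, hyz⟩ => ?_⟩
  have h1 := hπ.le x y hxy
  have h2 := hπ.le y z hyz
  rw [hπ.map_mem x hx] at h1
  rw [hπ.map_mem z hz] at h2
  suffices h : y = π y from h ▸ hπ.mem y
  rcases h1 with h1 | ⟨-, -, h1⟩ <;> rcases h2 with h2 | ⟨h2, -, -⟩
  · exact le_antisymm (h2 ▸ hyz) (h1 ▸ hxy)
  · exact le_antisymm h2 (h1 ▸ hxy)
  · exact le_antisymm (h2 ▸ hyz) h1
  · exact le_antisymm h2 h1

theorem IsGate.ordConnected_fibre {P : Type*} [PartialOrder P] {B : Set P} {π : P → P}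
    (hπ : IsGate B π) (u : P) : {x | π x = u}.OrdConnected := by
  refine ⟨fun x hx z hz y ⟨hxy, hyz⟩ => ?_⟩
  change π x = u at hx
  change π z = u at hz
  have h1 := hπ.le x y hxy
  have h2 := hπ.le y z hyz
  rw [hx] at h1
  rw [hz] at h2
  rcases h1 with h1 | ⟨-, h1, -⟩
  · exact h1.symm
  · rcases h2 with h2 | ⟨-, h2, -⟩
    · exact h2
    · exact le_antisymm h2 h1

theorem isBlock_of_maximal {P : Type*} [PartialOrder P] [Finite P] {B : Set P}
    (hB : Maximal (NonsepOn (SimpleGraph.hasse P)) B) : IsBlock B := by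
  obtain ⟨π, hπ⟩ := exists_isGate hB
  refine ⟨hπ.ordConnected, ?_, ?_, ?_⟩
  · exact (SimpleGraph.Subgraph.isInduced_iff_exists_eq_induce_top _).2 ⟨B, rfl⟩
  · exact isNonseparable_coe_induce_iff.2 hB.1
  · intro H hH hns
    have hle : H.coe ≤ (SimpleGraph.hasse P).induce H.verts := fun a b hab => hab.adj_sub
    have hverts := isNonseparable_induce_iff.1 (hns.mono hle)
    have hsub : H.verts ⊆ B := hB.2 hverts hH.le.1
    refine hH.not_ge ⟨hsub, fun a b hab => ?_⟩
    exact ⟨hsub (H.edge_vert hab), hsub (H.edge_vert hab.symm), hab.adj_sub⟩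

theorem hasRealizer_of_isEmpty {P : Type*} [PartialOrder P] [IsEmpty P] (k : ℕ) :
    HasRealizer P k :=
  HasRealizer.of_reversing (fun _ x y => x ≤ y) (fun _ _ _ h => h)
    (fun _ _ _ => le_antisymm) (fun _ _ _ _ => le_trans) fun x => isEmptyElim x

/-- If all nonseparable sets of the cover graph have realizers of size `d`, then `P` has a rooted
realizer at every point. The induction removes the block at the root. -/
theorem hasRootedRealizer_of_nonsepOn {d : ℕ} (n : ℕ) :
    ∀ (P : Type*) [PartialOrder P] [Finite P], Nat.card P = n →
      (∀ S : Set P, NonsepOn (SimpleGraph.hasse P) S → HasRealizer S d) →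
        ∀ r : P, HasRootedRealizer P d r := by
  induction n using Nat.strong_induction_on with
  | _ n ih =>
    intro P _ _ hn hS r
    -- The hypothesis passes to convex subposets.
    have hsub : ∀ (T : Set P), T.OrdConnected → ∀ x, x ∉ T → ∀ t : T,
        HasRootedRealizer T d t := by
      intro T hT x hx t
      refine ih (Nat.card T) ?_ T rfl (fun S hST => ?_) t
      · rw [← hn]
        exact Set.ncard_lt_card (Set.ne_univ_iff_exists_notMem T |>.2 ⟨x, hx⟩)
      · rw [hasse_eq_induce T hT] at hST
        exact (hS _ hST.image).comap
          (OrderEmbedding.ofMapLEIff (fun s => ⟨s, s, s.2, rfl⟩) fun _ _ => Iff.rfl)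
    by_cases hr : ∃ s, (SimpleGraph.hasse P).Adj r s
    · obtain ⟨s, hs⟩ := hr
      obtain ⟨B, hrB, hB⟩ := exists_maximal_nonsepOn (nonsepOn_pair hs)
      obtain ⟨π, hπ⟩ := exists_isGate hB
      refine hπ.hasRootedRealizer (hS B hB.1) (fun u hu => ?_) (hrB (by simp))
      have hx : ∃ x, x ∉ {x | π x = u} := by
        by_contra! h
        have h1 : π r = u := h r
        have h2 : π s = u := h s
        rw [hπ.map_mem _ (hrB (by simp))] at h1 h2
        exact hs.ne (h1.trans h2.symm)
      obtain ⟨x, hx⟩ := hx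
      exact hsub {x | π x = u} (hπ.ordConnected_fibre u) x hx ⟨u, hu⟩
    · push Not at hr
      have := Fintype.ofFinite P
      classical
      let _ : LocallyFiniteOrder P := Fintype.toLocallyFiniteOrder
      have h1 : ∀ x, x ≤ r → x = r := fun x hx => by
        rcases (le_iff_reflTransGen_covBy.1 hx).cases_tail with h | ⟨c, -, hc⟩
        · exact h.symm
        · exact absurd (Or.inr hc) (hr c)
      have h2 : ∀ x, r ≤ x → x = r := fun x hx => by
        rcases (le_iff_reflTransGen_covBy.1 hx).cases_head with h | ⟨c, hc, -⟩
        · exact h.symm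
        · exact absurd (Or.inl hc) (hr c)
      refine hasRootedRealizer_of_isolated h1 h2 ?_
      rcases isEmpty_or_nonempty {x // x ≠ r} with h | ⟨⟨q⟩⟩
      · exact hasRealizer_of_isEmpty _
      · refine (hsub {x | x ≠ r} ⟨fun x hx z hz y hy => ?_⟩ r (by simp) q).hasRealizer
        rintro rfl
        exact hx (h1 x hy.1)

theorem dim_le_of_blocks {d : ℕ} (hd : 1 ≤ d) (P : Type*) [PartialOrder P] [Finite P]
    (h : ∀ B : Set P, IsBlock B → dim B ≤ (d : ℕ∞)) : dim P ≤ (d : ℕ∞) + 2 := by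
  have h2 : ((d : ℕ∞) + 2) = ((d + 2 : ℕ) : ℕ∞) := by push_cast; rfl
  rw [h2, dim_le_iff (by omega)]
  rcases isEmpty_or_nonempty P with _ | ⟨⟨r⟩⟩
  · exact hasRealizer_of_isEmpty _
  refine (hasRootedRealizer_of_nonsepOn _ P rfl (fun S hS => ?_) r).hasRealizer
  obtain ⟨B, hSB, hB⟩ := exists_maximal_nonsepOn hS
  exact ((dim_le_iff hd).1 (h B (isBlock_of_maximal hB))).comap
    ⟨⟨Set.inclusion hSB, Set.inclusion_injective hSB⟩, Iff.rfl⟩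

/-! ### A product Ramsey theorem -/

/-- Ramsey's theorem for triangles, with the colours on `S` drawn from a given finite set. -/
theorem exists_triangle_of_card {C : Type*} [DecidableEq C] (c : ℕ) :
    ∃ n, ∀ (K : Finset C), K.card ≤ c → ∀ (S : Finset ℕ), n ≤ S.card → ∀ f : ℕ → ℕ → C,
      (∀ x ∈ S, ∀ y ∈ S, x < y → f x y ∈ K) →
      ∃ x ∈ S, ∃ y ∈ S, ∃ z ∈ S, x < y ∧ y < z ∧ f x z = f x y ∧ f y z = f x y := by
  induction c with
  | zero =>
    refine ⟨2, fun K hK S hS f hf => ?_⟩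
    obtain ⟨x, hx, y, hy, hxy⟩ := Finset.one_lt_card.1 hS
    rw [Nat.le_zero, Finset.card_eq_zero] at hK
    subst hK
    rcases lt_or_gt_of_ne hxy with h | h
    · exact absurd (hf x hx y hy h) (by simp)
    · exact absurd (hf y hy x hx h) (by simp)
  | succ c ih =>
    obtain ⟨n, hn⟩ := ih
    refine ⟨(c + 1) * n + 2, fun K hK S hS f hf => ?_⟩
    have hne : S.Nonempty := Finset.card_pos.1 (by omega)
    set v := S.min' hne
    have hv : v ∈ S := S.min'_mem hne
    have hlt : ∀ x ∈ S.erase v, v < x := fun x hx =>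
      lt_of_le_of_ne (S.min'_le x (Finset.mem_of_mem_erase hx)) (Finset.ne_of_mem_erase hx).symm
    have hmaps : ∀ x ∈ S.erase v, f v x ∈ K := fun x hx =>
      hf v hv x (Finset.mem_of_mem_erase hx) (hlt x hx)
    have hcard : K.card * n < (S.erase v).card := by
      rw [Finset.card_erase_of_mem hv]
      have := Nat.mul_le_mul_right n hK
      omega
    obtain ⟨k, hk, hk'⟩ := Finset.exists_lt_card_fiber_of_mul_lt_card_of_maps_to hmaps hcard
    set S' := (S.erase v).filter fun x => f v x = k
    have hS' : ∀ x ∈ S', x ∈ S ∧ v < x ∧ f v x = k := fun x hx => by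
      obtain ⟨h1, h2⟩ := Finset.mem_filter.1 hx
      exact ⟨Finset.mem_of_mem_erase h1, hlt x h1, h2⟩
    by_cases h : ∃ x ∈ S', ∃ y ∈ S', x < y ∧ f x y = k
    · obtain ⟨x, hx, y, hy, hxy, hfxy⟩ := h
      obtain ⟨h1, h2, h3⟩ := hS' x hx
      obtain ⟨h4, -, h6⟩ := hS' y hy
      exact ⟨v, hv, x, h1, y, h4, h2, hxy, h6.trans h3.symm, hfxy.trans h3.symm⟩
    · push Not at h
      obtain ⟨x, hx, y, hy, z, hz, H⟩ := hn (K.erase k)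
        (by rw [Finset.card_erase_of_mem hk]; omega) S' hk'.le f fun x hx y hy hxy =>
          Finset.mem_erase.2 ⟨h x hx y hy hxy, hf x (hS' x hx).1 y (hS' y hy).1 hxy⟩
      exact ⟨x, (hS' x hx).1, y, (hS' y hy).1, z, (hS' z hz).1, H⟩

theorem exists_monochromatic_triangle (C : Type*) [Finite C] :
    ∃ n, ∀ f : ℕ → ℕ → C, ∃ h : Fin 3 → ℕ, StrictMono h ∧ (∀ i, h i < n) ∧
      ∃ c, ∀ i j, i < j → f (h i) (h j) = c := by
  classical
  have := Fintype.ofFinite C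
  obtain ⟨n, hn⟩ := exists_triangle_of_card (C := C) (Fintype.card C)
  refine ⟨n, fun f => ?_⟩
  obtain ⟨x, hx, y, hy, z, hz, hxy, hyz, h1, h2⟩ :=
    hn Finset.univ le_rfl (Finset.range n) (by simp) f (by simp)
  refine ⟨![x, y, z], ?_, ?_, f x y, ?_⟩
  · rw [Fin.strictMono_iff_lt_succ]
    simp [Fin.forall_fin_succ, hxy, hyz]
  · rw [Finset.mem_range] at hx hy hz
    simpa [Fin.forall_fin_succ] using ⟨hx, hy, hz⟩
  · simp [Fin.forall_fin_succ, h1, h2]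

/-- The product Ramsey theorem for pairs and homogeneous sets of size three: a finite colouring of
the pairs `p < q` (in all coordinates) of a large `d`-dimensional grid is constant on the pairs of
a subgrid with three elements in each coordinate. -/
theorem exists_monochromatic_grid (d : ℕ) : ∀ (C : Type) [Finite C],
    ∃ n, ∀ f : (Fin d → ℕ) → (Fin d → ℕ) → C, ∃ h : Fin d → Fin 3 → ℕ,
      (∀ j, StrictMono (h j)) ∧ (∀ j i, h j i < n) ∧
      ∃ c, ∀ a b : Fin d → Fin 3, (∀ j, a j < b j) →
        f (fun j => h j (a j)) (fun j => h j (b j)) = c := by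
  induction d with
  | zero =>
    intro C _
    refine ⟨0, fun f => ⟨fun j => j.elim0, fun j => j.elim0, fun j => j.elim0,
      f Fin.elim0 Fin.elim0, fun a b _ => ?_⟩⟩
    congr 1 <;> exact Subsingleton.elim _ _
  | succ d ih =>
    intro C _
    obtain ⟨n₀, h₀⟩ := exists_monochromatic_triangle C
    -- Colour a pair of the `d`-dimensional grid by all the colours it gets from pairs in the
    -- remaining coordinate.
    obtain ⟨n₁, h₁⟩ := ih (Fin n₀ → Fin n₀ → C)
    refine ⟨max n₀ n₁, fun f => ?_⟩
    obtain ⟨h, hmono, hlt, c, hc⟩ := h₁ fun p q s t => f (Fin.cons s p) (Fin.cons t q)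
    have hn₀ : 0 < n₀ := by
      obtain ⟨g, -, hg, -⟩ := h₀ fun _ _ => f 0 0
      exact (Nat.zero_le _).trans_lt (hg 0)
    obtain ⟨g, gmono, glt, c', hc'⟩ := h₀ fun s t =>
      c ⟨s % n₀, Nat.mod_lt _ hn₀⟩ ⟨t % n₀, Nat.mod_lt _ hn₀⟩
    refine ⟨Fin.cons g h, ?_, ?_, c', fun a b hab => ?_⟩
    · simpa [Fin.forall_fin_succ] using ⟨gmono, hmono⟩
    · simp only [Fin.forall_fin_succ (n := d), Fin.cons_zero, Fin.cons_succ, lt_max_iff]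
      exact ⟨fun i => Or.inl (glt i), fun j i => Or.inr (hlt j i)⟩
    · have e : ∀ a : Fin (d + 1) → Fin 3,
          (fun j => (Fin.cons g h : Fin (d + 1) → Fin 3 → ℕ) j (a j)) =
            (Fin.cons (g (a 0)) fun j => h j (a j.succ) : Fin (d + 1) → ℕ) := by
        intro a
        funext j
        refine Fin.cases ?_ (fun j => ?_) j <;> simp
      rw [e a, e b, ← hc' (a 0) (b 0) (hab 0)]
      have := congrFun (congrFun (hc (fun j => a j.succ) (fun j => b j.succ) fun j => hab j.succ)
        ⟨g (a 0), glt _⟩) ⟨g (b 0), glt _⟩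
      simpa [Nat.mod_eq_of_lt (glt _)] using this

theorem exists_monochromatic_subgrid (d : ℕ) (C : Type) [Finite C] :
    ∃ n, ∀ f : (Fin d → Fin n) → (Fin d → Fin n) → C, ∃ h : Fin d → Fin 3 → Fin n,
      (∀ j, StrictMono (h j)) ∧ ∃ c, ∀ a b : Fin d → Fin 3, (∀ j, a j < b j) →
        f (fun j => h j (a j)) (fun j => h j (b j)) = c := by
  obtain ⟨n, hn⟩ := exists_monochromatic_grid d C
  refine ⟨n + 1, fun f => ?_⟩
  obtain ⟨h, hmono, hlt, c, hc⟩ := hn fun p q =>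
    f (fun j => Fin.ofNat (n + 1) (p j)) (fun j => Fin.ofNat (n + 1) (q j))
  refine ⟨fun j i => Fin.ofNat (n + 1) (h j i), fun j i i' hi => ?_, c, hc⟩
  rw [Fin.lt_def, Fin.val_ofNat, Fin.val_ofNat, Nat.mod_eq_of_lt ((hlt j i).trans (by omega)),
    Nat.mod_eq_of_lt ((hlt j i').trans (by omega))]
  exact hmono j hi

/-! ### Grids with a diamond hung at every point -/

theorem hasRealizer_pi (d : ℕ) (α : Type*) [LinearOrder α] : HasRealizer (Fin d → α) d := by
  refine HasRealizer.of_reversing (fun i x y => x i < y i ∨ (x i = y i ∧ x ≤ y)) ?_ ?_ ?_ ?_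
  · exact fun i x y h => (h i).lt_or_eq.imp_right fun e => ⟨e, h⟩
  · rintro i x y (h | ⟨e, h⟩) (h' | ⟨e', h'⟩)
    · exact absurd h' h.not_gt
    · exact absurd e' h.ne'
    · exact absurd e h'.ne'
    · exact le_antisymm h h'
  · rintro i x y z (h | ⟨e, h⟩) (h' | ⟨e', h'⟩)
    · exact Or.inl (h.trans h')
    · exact Or.inl (e' ▸ h)
    · exact Or.inl (e ▸ h')
    · exact Or.inr ⟨e.trans e', h.trans h'⟩
  · intro x y h
    obtain ⟨i, hi⟩ := not_forall.1 h
    exact ⟨i, Or.inl (not_le.1 hi)⟩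

/-- The poset obtained from `V` by identifying each `u ∈ V` with the element `(true, false)` of its
own copy of the diamond `Bool × Bool`. -/
def Hung (V : Type*) : Type _ := V × (Bool × Bool)

instance (V : Type*) [Finite V] : Finite (Hung V) := inferInstanceAs (Finite (V × (Bool × Bool)))

/-- Elements of distinct diamonds are comparable only through the points of `V` at which
the diamonds hang; an element of a diamond is below `(true, false)` when its second component is
`false`, and above it when its first component is `true`. -/
instance (V : Type*) [PartialOrder V] : PartialOrder (Hung V) where
  le p q := (p.1 = q.1 ∧ p.2 ≤ q.2) ∨ (p.1 < q.1 ∧ p.2.2 = false ∧ q.2.1 = true)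
  le_refl p := Or.inl ⟨rfl, le_rfl⟩
  le_trans := by
    rintro ⟨u, a⟩ ⟨v, b⟩ ⟨w, c⟩ (⟨h1, h2⟩ | ⟨h1, h2, h3⟩) (⟨h1', h2'⟩ | ⟨h1', h2', h3'⟩)
    · exact Or.inl ⟨h1.trans h1', h2.trans h2'⟩
    · exact Or.inr ⟨h1.trans_lt h1', le_bot_iff.1 (h2.2.trans_eq h2'), h3'⟩
    · exact Or.inr ⟨h1.trans_eq h1', h2, top_le_iff.1 (h3.symm.trans_le h2'.1)⟩
    · exact Or.inr ⟨h1.trans h1', h2, h3'⟩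
  le_antisymm := by
    rintro ⟨u, a⟩ ⟨v, b⟩ (⟨h1, h2⟩ | ⟨h1, h2, h3⟩) (⟨h1', h2'⟩ | ⟨h1', h2', h3'⟩)
    · exact Prod.ext h1 (le_antisymm h2 h2')
    · exact absurd h1 h1'.ne'
    · exact absurd h1' h1.ne'
    · exact absurd h1' h1.not_gt

namespace Hung

variable {V : Type*} [PartialOrder V]

theorem le_def {p q : Hung V} : p ≤ q ↔
    (p.1 = q.1 ∧ p.2 ≤ q.2) ∨ (p.1 < q.1 ∧ p.2.2 = false ∧ q.2.1 = true) :=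
  Iff.rfl

/-- The bottom of the diamond hung at `u`. -/
def bot (u : V) : Hung V := (u, false, false)

/-- The point `u` of the base. -/
def base (u : V) : Hung V := (u, true, false)

/-- The element of the diamond hung at `u` that is incomparable to `u`. -/
def side (u : V) : Hung V := (u, false, true)

/-- The top of the diamond hung at `u`. -/
def top (u : V) : Hung V := (u, true, true)

theorem le_of_le {p q : Hung V} (h : p.1 ≤ q.1) (hp : p.2.2 = false) (hq : q.2.1 = true) :
    p ≤ q := by
  rcases h.eq_or_lt with h | h
  · exact Or.inl ⟨h, hq ▸ Bool.le_true _, hp ▸ Bool.false_le _⟩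
  · exact Or.inr ⟨h, hp, hq⟩

theorem bot_le_side (u : V) : bot u ≤ side u := Or.inl ⟨rfl, by simp [bot, side]⟩

theorem side_le_top (u : V) : side u ≤ top u := Or.inl ⟨rfl, by simp [side, top]⟩

theorem not_side_le_base (u v : V) : ¬ side u ≤ base v := by
  rintro (⟨-, h⟩ | ⟨-, h, -⟩)
  · exact absurd h.2 (show ¬ true ≤ false by decide)
  · simp [side] at h

theorem not_base_le_side (u v : V) : ¬ base u ≤ side v := by
  rintro (⟨-, h⟩ | ⟨-, -, h⟩)
  · exact absurd h.1 (show ¬ true ≤ false by decide)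
  · simp [side] at h

theorem le_of_bot_le_top {u v : V} (h : bot u ≤ top v) : u ≤ v :=
  h.elim (fun h => h.1.le) (fun h => h.1.le)

/-- A cover of elements of distinct diamonds is a cover of points of the base. -/
theorem eq_base_of_covBy {p q : Hung V} (h : p ⋖ q) (hne : p.1 ≠ q.1) :
    p = base p.1 ∧ q = base q.1 := by
  obtain ⟨hlt, hp, hq⟩ := h.le.resolve_left fun e => hne e.1
  constructor
  · have h1 : p ≤ base p.1 := le_of_le le_rfl hp rfl
    have h2 : base p.1 < q := lt_of_le_of_ne (le_of_le hlt.le rfl hq) fun e =>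
      hne (congrArg Prod.fst e : (base p.1).1 = q.1)
    exact h1.eq_or_lt.resolve_right fun h1 => h.2 h1 h2
  · have h1 : base q.1 ≤ q := le_of_le le_rfl rfl hq
    have h2 : p < base q.1 := lt_of_le_of_ne (le_of_le hlt.le hp rfl) fun e =>
      hne (congrArg Prod.fst e : p.1 = (base q.1).1)
    exact (h1.eq_or_lt.resolve_right fun h1 => h.2 h2 h1).symm

/-- A block lies in the base or in one of the diamonds. -/
theorem subset_of_nonsepOn {B : Set (Hung V)} (hB : NonsepOn (SimpleGraph.hasse (Hung V)) B) :
    (∀ p ∈ B, p = base p.1) ∨ ∃ u, ∀ p ∈ B, p.1 = u := by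
  by_contra! h
  obtain ⟨⟨p, hp, hne⟩, h⟩ := h
  have hT : ∀ a b, (SimpleGraph.hasse (Hung V)).Adj a b → a ∈ {q : Hung V | q.1 = p.1} →
      b ∉ {q : Hung V | q.1 = p.1} → a = base p.1 := by
    intro a b hab ha hb
    change a.1 = p.1 at ha
    have hab' : a.1 ≠ b.1 := fun e => hb (e.symm.trans ha)
    rw [← ha]
    rcases hab with hab | hab
    · exact (eq_base_of_covBy hab hab').1
    · exact (eq_base_of_covBy hab hab'.symm).2
  rcases hB.subset_or hT with h' | h'
  · obtain ⟨q, hq, hqp⟩ := h p.1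
    exact hqp (h' hq)
  · exact hne (h' p hp rfl)

theorem dim_block_le {d : ℕ} (hd : 2 ≤ d) (hV : HasRealizer V d) {B : Set (Hung V)}
    (hB : IsBlock B) : dim B ≤ (d : ℕ∞) := by
  rw [dim_le_iff (by omega)]
  rcases subset_of_nonsepOn hB.nonsepOn with h | ⟨u, h⟩
  · refine hV.comap (OrderEmbedding.ofMapLEIff (fun p => (p : Hung V).1) fun p q => ?_)
    refine ⟨fun hpq => ?_, fun hpq => ?_⟩
    · change (p : Hung V) ≤ q
      rw [h p p.2, h q q.2]
      exact le_of_le hpq rfl rfl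
    · exact hpq.elim (fun h => h.1.le) (fun h => h.1.le)
  · have h2 : HasRealizer (Bool × Bool) 2 :=
      (hasRealizer_pi 2 Bool).comap (OrderIso.finTwoArrowIso Bool).symm.toOrderEmbedding
    refine (h2.mono (by omega) hd).comap
      (OrderEmbedding.ofMapLEIff (fun p => (p : Hung V).2) fun p q => ?_)
    have hpq : (p : Hung V).1 = (q : Hung V).1 := (h p p.2).trans (h q q.2).symm
    refine ⟨fun hle => Or.inl ⟨hpq, hle⟩, fun hle => ?_⟩
    exact (le_def.1 hle).elim And.right fun h => absurd hpq h.1.ne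

end Hung

/-- The pairs of elements that a realizer of a hung grid has to reverse, for points `p < q` of
the grid. For `Sum.inl j` the pair comes from the points that are obtained from `p` and `q` by
exchanging their `j`-th coordinates. -/
def criticalPair {d : ℕ} {α : Type*} (p q : Fin d → α) :
    Fin d ⊕ Bool → Hung (Fin d → α) × Hung (Fin d → α)
  | Sum.inl j => (Hung.bot (Function.update p j (q j)), Hung.top (Function.update q j (p j)))
  | Sum.inr true => (Hung.side p, Hung.base q)
  | Sum.inr false => (Hung.base p, Hung.side q)

theorem not_le_criticalPair {d : ℕ} {α : Type*} [LinearOrder α] {p q : Fin d → α}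
    (hpq : ∀ j, p j < q j) (t : Fin d ⊕ Bool) :
    ¬ (criticalPair p q t).1 ≤ (criticalPair p q t).2 := by
  match t with
  | Sum.inl j =>
    intro h
    have := Hung.le_of_bot_le_top h j
    simp only [Function.update_self] at this
    exact this.not_gt (hpq j)
  | Sum.inr true => exact Hung.not_side_le_base p q
  | Sum.inr false => exact Hung.not_base_le_side p q

/-- For large `n`, a realizer of the hung `d`-dimensional grid has at least `d + 2` members. By the
product Ramsey theorem, the member reversing a critical pair may be taken to depend only on the type
of the pair; and no member reverses critical pairs of two types throughout a `3 × ⋯ × 3` grid. -/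
theorem exists_forall_hasRealizer_hung (d k : ℕ) :
    ∃ n, HasRealizer (Hung (Fin d → Fin n)) k → d + 2 ≤ k := by
  obtain ⟨n, hn⟩ := exists_monochromatic_subgrid d (Fin d ⊕ Bool → Fin k)
  refine ⟨n, fun ⟨L, hL, hLe⟩ => ?_⟩
  have hrev : ∀ p q (t : Fin d ⊕ Bool), ∃ i, (∀ j, p j < q j) →
      ¬ L i (criticalPair p q t).1 (criticalPair p q t).2 := by
    intro p q t
    by_cases hpq : ∀ j, p j < q j
    · have := not_le_criticalPair hpq t
      rw [hLe, not_forall] at this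
      exact this.imp fun i hi _ => hi
    · have := Hung.not_side_le_base p q
      rw [hLe, not_forall] at this
      exact this.imp fun i _ h => absurd h hpq
  choose f hf using hrev
  obtain ⟨h, hmono, c, hc⟩ := hn f
  set g : (Fin d → Fin 3) → Fin d → Fin n := fun a j => h j (a j)
  have hg : ∀ {a b : Fin d → Fin 3}, a ≤ b → g a ≤ g b := fun hab j => (hmono j).monotone (hab j)
  have hcrit : ∀ (a b : Fin d → Fin 3) t, (∀ j, a j < b j) →
      L (c t) (criticalPair (g a) (g b) t).2 (criticalPair (g a) (g b) t).1 := by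
    intro a b t hab
    have := hf (g a) (g b) t fun j => hmono j (hab j)
    rw [hc a b hab] at this
    exact (hL _).of_not this
  have hcrit' : ∀ (a b : Fin d → Fin 3) t, (∀ j, a j < b j) →
      ¬ L (c t) (criticalPair (g a) (g b) t).1 (criticalPair (g a) (g b) t).2 := by
    intro a b t hab
    rw [← hc a b hab]
    exact hf (g a) (g b) t fun j => hmono j (hab j)
  have hupd : ∀ (s t : Fin d → Fin 3) j, g (Function.update s j (t j)) =
      Function.update (g s) j (g t j) := by
    intro s t j
    funext l
    by_cases hl : l = j
    · subst hl
      simp [g]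
    · simp [g, hl]
  -- The critical pairs of type `j`, in terms of the points with exchanged coordinates.
  have hswap : ∀ (s t : Fin d → Fin 3) j, t j < s j → (∀ l ≠ j, s l < t l) →
      ¬ L (c (Sum.inl j)) (Hung.bot (g s)) (Hung.top (g t)) := by
    intro s t j hj hl
    have := hcrit' (Function.update s j (t j)) (Function.update t j (s j)) (Sum.inl j) fun l => by
      by_cases h : l = j
      · subst h
        simpa using hj
      · simpa [h] using hl l h
    simpa [criticalPair, hupd] using this
  have hle := fun i => (hL i).extends_le
  have htrans := fun i => (hL i).trans
  have h01 : ∀ _ : Fin d, (0 : Fin 3) < 1 := fun _ => by decide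
  have h12 : ∀ _ : Fin d, (1 : Fin 3) < 2 := fun _ => by decide
  have hinj : Function.Injective c := by
    have hjk : ∀ j k, j ≠ k → c (Sum.inl j) ≠ c (Sum.inl k) := by
      intro j k hne hcc
      let s : Fin d → Fin 3 := fun l => if l = j then 1 else 0
      let t : Fin d → Fin 3 := fun l => if l = j then 0 else 1
      let r : Fin d → Fin 3 := fun l => if l = j then 1 else if l = k then 0 else 2
      have h1 := hswap s t j (by simp [s, t]) (fun l hl => by simp [s, t, hl])
      have h2 := hswap t r k (by simp [t, r, hne.symm]) (fun l hl => by
        by_cases h : l = j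
        · simp [t, r, h]
        · simp [t, r, h, hl])
      rw [← hcc] at h2
      have hsr : s ≤ r := fun l => by
        by_cases h : l = j
        · simp [s, r, h]
        · simp [s, h]
      refine h2 (htrans _ _ _ _ (hle _ _ (Hung.top (g t)) (Hung.le_of_le le_rfl rfl rfl)) ?_)
      exact htrans _ _ _ _ ((hL _).of_not h1) (hle _ _ _ (Hung.le_of_le (hg hsr) rfl rfl))
    have hjt : ∀ j, c (Sum.inl j) ≠ c (Sum.inr true) := by
      intro j hcc
      let t : Fin d → Fin 3 := fun l => if l = j then 2 else 0
      have h1 := hswap t 1 j (by simp [t]) (fun l hl => by simp [t, hl])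
      have h2 := hcrit' 1 2 (Sum.inr true) h12
      rw [← hcc] at h2
      have ht : t ≤ 2 := fun l => by
        by_cases h : l = j <;> simp [t, h]
      refine h2 (htrans _ _ _ _ (hle _ _ _ (Hung.side_le_top _)) ?_)
      exact htrans _ _ _ _ ((hL _).of_not h1) (hle _ _ _ (Hung.le_of_le (hg ht) rfl rfl))
    have hjf : ∀ j, c (Sum.inl j) ≠ c (Sum.inr false) := by
      intro j hcc
      let t : Fin d → Fin 3 := fun l => if l = j then 0 else 2
      have h1 := hswap 1 t j (by simp [t]) (fun l hl => by simp [t, hl])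
      have h2 := hcrit' 0 1 (Sum.inr false) h01
      rw [← hcc] at h2
      have ht : 0 ≤ t := fun l => by
        by_cases h : l = j <;> simp [t, h]
      refine h2 (htrans _ _ _ _ (hle _ (Hung.base (g 0)) (Hung.top (g t))
        (Hung.le_of_le (hg ht) rfl rfl)) ?_)
      exact htrans _ _ _ _ ((hL _).of_not h1) (hle _ _ _ (Hung.bot_le_side _))
    have htf : c (Sum.inr true) ≠ c (Sum.inr false) := by
      intro hcc
      have h1 := hcrit' 1 2 (Sum.inr true) h12
      have h2 := hcrit' 0 1 (Sum.inr false) h01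
      rw [← hcc] at h2
      have h02 : (0 : Fin d → Fin 3) ≤ 2 := fun _ => show (0 : Fin 3) ≤ 2 by decide
      exact h2 (htrans _ _ _ _ (hle _ (Hung.base (g 0)) (Hung.base (g 2))
        (Hung.le_of_le (hg h02) rfl rfl)) ((hL _).of_not h1))
    rintro (j | (_ | _)) (k | (_ | _)) hcc
    · by_contra hne
      exact hjk j k (fun e => hne (congrArg _ e)) hcc
    · exact absurd hcc (hjf j)
    · exact absurd hcc (hjt j)
    · exact absurd hcc.symm (hjf k)
    · rfl
    · exact absurd hcc.symm htf
    · exact absurd hcc.symm (hjt k)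
    · exact absurd hcc htf
    · rfl
  simpa using Fintype.card_le_of_injective c hinj

/-! ### The spider -/

/-- The seven-element poset consisting of a minimal element, three maximal elements `knee i` above
it, and for each `i` a further minimal element `foot i` below `knee i` alone. Its cover graph is
a tree: three paths of length two from the centre. -/
inductive Spider : Type
  | centre : Spider
  | knee : Fin 3 → Spider
  | foot : Fin 3 → Spider

namespace Spider

instance : Finite Spider :=
  Finite.of_surjective (fun o : Option (Fin 3 ⊕ Fin 3) => o.elim centre (Sum.elim knee foot)) fun
    | centre => ⟨none, rfl⟩
    | knee i => ⟨some (Sum.inl i), rfl⟩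
    | foot i => ⟨some (Sum.inr i), rfl⟩

instance : PartialOrder Spider where
  le p q := p = q ∨ ∃ i, q = knee i ∧ (p = centre ∨ p = foot i)
  le_refl p := Or.inl rfl
  le_trans := by
    rintro p q r (rfl | ⟨i, rfl, h⟩) (rfl | ⟨j, rfl, h'⟩)
    · exact Or.inl rfl
    · exact Or.inr ⟨j, rfl, h'⟩
    · exact Or.inr ⟨i, rfl, h⟩
    · simp at h'
  le_antisymm := by
    rintro p q (rfl | ⟨i, rfl, h⟩) (h' | ⟨j, rfl, h'⟩)
    · rfl
    · rfl
    · exact h'.symm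
    · simp at h

theorem le_def {p q : Spider} :
    p ≤ q ↔ p = q ∨ ∃ i, q = knee i ∧ (p = centre ∨ p = foot i) :=
  Iff.rfl

theorem centre_le_knee (i : Fin 3) : centre ≤ knee i := Or.inr ⟨i, rfl, Or.inl rfl⟩

theorem foot_le_knee (i : Fin 3) : foot i ≤ knee i := Or.inr ⟨i, rfl, Or.inr rfl⟩

theorem not_centre_le_foot (i : Fin 3) : ¬ centre ≤ foot i := by
  simp [le_def]

theorem not_foot_le_knee {i j : Fin 3} (hij : i ≠ j) : ¬ foot i ≤ knee j := by
  simp [le_def, hij]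

/-- The edges of the cover graph. -/
theorem adj_cases {p q : Spider} (h : (SimpleGraph.hasse Spider).Adj p q) : ∃ i,
    (q = knee i ∧ (p = centre ∨ p = foot i)) ∨ (p = knee i ∧ (q = centre ∨ q = foot i)) := by
  rcases h with h | h
  · obtain ⟨i, hi⟩ := (le_def.1 h.le).resolve_left h.lt.ne
    exact ⟨i, Or.inl hi⟩
  · obtain ⟨i, hi⟩ := (le_def.1 h.le).resolve_left h.lt.ne
    exact ⟨i, Or.inr hi⟩

/-- The blocks are contained in edges of the cover graph, and are chains. -/
theorem total_of_nonsepOn {B : Set Spider} (hB : NonsepOn (SimpleGraph.hasse Spider) B) :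
    ∀ p ∈ B, ∀ q ∈ B, p ≤ q ∨ q ≤ p := by
  have h1 : ∀ i, B ⊆ {centre, knee i, foot i} ∨
      ∀ p ∈ B, p ∈ ({centre, knee i, foot i} : Set Spider) → p = centre := by
    intro i
    refine hB.subset_or fun p q hpq hp hq => ?_
    simp only [Set.mem_insert_iff, Set.mem_singleton_iff] at hp hq
    obtain ⟨j, ⟨rfl, hj⟩ | ⟨rfl, hj⟩⟩ := adj_cases hpq
    · grind
    · grind
  have h2 : ∀ i, B ⊆ {knee i, foot i} ∨
      ∀ p ∈ B, p ∈ ({knee i, foot i} : Set Spider) → p = knee i := by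
    intro i
    refine hB.subset_or fun p q hpq hp hq => ?_
    simp only [Set.mem_insert_iff, Set.mem_singleton_iff] at hp hq
    obtain ⟨j, ⟨rfl, hj⟩ | ⟨rfl, hj⟩⟩ := adj_cases hpq
    · grind
    · grind
  by_cases h : ∃ i, B ⊆ {centre, knee i, foot i}
  · obtain ⟨i, hi⟩ := h
    have hle1 := centre_le_knee i
    have hle2 := foot_le_knee i
    rcases h2 i with h2 | h2
    · intro p hp q hq
      rcases h2 hp with rfl | rfl <;> rcases h2 hq with rfl | rfl <;> simp_all
    · have h3 : ∀ p ∈ B, p = centre ∨ p = knee i := fun p hp => by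
        rcases hi hp with h | h | h
        · exact Or.inl h
        · exact Or.inr h
        · exact Or.inr (h2 p hp (Or.inr h))
      intro p hp q hq
      rcases h3 p hp with rfl | rfl <;> rcases h3 q hq with rfl | rfl <;> simp_all
  · have h3 : ∀ p ∈ B, p = centre := fun p hp => by
      have h3 : ∀ i, p ∈ ({centre, knee i, foot i} : Set Spider) → p = centre := fun i =>
        (h1 i).resolve_left (fun hi => h ⟨i, hi⟩) p hp
      match p with
      | centre => rfl
      | knee i => exact h3 i (by simp)
      | foot i => exact h3 i (by simp)
    intro p hp q hq
    rw [h3 p hp, h3 q hq]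
    simp

theorem dim_block_le {B : Set Spider} (hB : IsBlock B) : dim B ≤ ((1 : ℕ) : ℕ∞) := by
  rw [dim_le_iff one_pos]
  have h := total_of_nonsepOn hB.nonsepOn
  refine HasRealizer.of_reversing (fun _ x y => x ≤ y) (fun _ _ _ h => h)
    (fun _ _ _ => le_antisymm) (fun _ _ _ _ => le_trans) fun x y hxy => ⟨0, ?_⟩
  exact (h x x.2 y y.2).resolve_left hxy

/-- A linear extension with the centre above a foot has that foot below all knees. With only two
linear extensions, two feet would both have to exceed the other's knee in the same one. -/
theorem three_le_of_hasRealizer {k : ℕ} (h : HasRealizer Spider k) : 3 ≤ k := by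
  obtain ⟨L, hL, hLe⟩ := h
  have h1 : ∀ i, ∃ m, L m (foot i) centre := by
    intro i
    have := not_centre_le_foot i
    rw [hLe, not_forall] at this
    exact this.imp fun m hm => (hL m).of_not hm
  have h2 : ∀ i j, i ≠ j → ∃ m, ¬ L m (foot i) (knee j) := by
    intro i j hij
    have := not_foot_le_knee hij
    rwa [hLe, not_forall] at this
  choose m hm using h1
  by_contra hk
  obtain ⟨i, j, hij, hmij⟩ := Fintype.exists_ne_map_eq_of_card_lt m (by simpa using hk)
  obtain ⟨s, hs⟩ := h2 i j hij
  obtain ⟨t, ht⟩ := h2 j i hij.symm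
  have hsm : s ≠ m i := by
    rintro rfl
    exact hs ((hL _).trans _ _ _ (hm i) ((hL _).extends_le _ _ (centre_le_knee j)))
  have htm : t ≠ m i := by
    rintro rfl
    rw [hmij] at ht
    exact ht ((hL _).trans _ _ _ (hm j) ((hL _).extends_le _ _ (centre_le_knee i)))
  have hst : s = t := by
    simp only [ne_eq, Fin.ext_iff] at hsm htm ⊢
    omega
  subst hst
  refine hs ((hL s).trans _ _ _ ((hL s).extends_le _ _ (foot_le_knee i)) ?_)
  exact (hL s).trans _ _ _ ((hL s).of_not ht) ((hL s).extends_le _ _ (foot_le_knee j))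

end Spider

end PosetBlocks

theorem theorem1 (d : ℕ) (hd : 1 ≤ d) :
    (∀ (P : Type*) [PartialOrder P] [Finite P],
      (∀ B : Set P, PosetBlocks.IsBlock B → PosetBlocks.dim B ≤ (d : ℕ∞)) →
        PosetBlocks.dim P ≤ (d : ℕ∞) + 2) ∧
    (∃ (P : Type) (_ : PartialOrder P) (_ : Finite P),
      (∀ B : Set P, PosetBlocks.IsBlock B → PosetBlocks.dim B ≤ (d : ℕ∞)) ∧
        PosetBlocks.dim P = (d : ℕ∞) + 2) := by
  refine ⟨fun P _ _ h => PosetBlocks.dim_le_of_blocks hd P h, ?_⟩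
  rcases hd.eq_or_lt with rfl | hd2
  · have hB : ∀ B : Set PosetBlocks.Spider, PosetBlocks.IsBlock B →
        PosetBlocks.dim B ≤ ((1 : ℕ) : ℕ∞) := fun B hB => PosetBlocks.Spider.dim_block_le hB
    refine ⟨PosetBlocks.Spider, inferInstance, inferInstance, hB,
      le_antisymm (PosetBlocks.dim_le_of_blocks le_rfl _ hB) ?_⟩
    exact PosetBlocks.le_dim (d := 1 + 2) fun k hk => PosetBlocks.Spider.three_le_of_hasRealizer hk
  · -- A realizer with at most `d + 1` members may be padded to have exactly `d + 1`.
    obtain ⟨n, hn⟩ := PosetBlocks.exists_forall_hasRealizer_hung d (d + 1)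
    have hB : ∀ B : Set (PosetBlocks.Hung (Fin d → Fin n)), PosetBlocks.IsBlock B →
        PosetBlocks.dim B ≤ (d : ℕ∞) := fun B hB =>
      PosetBlocks.Hung.dim_block_le hd2 (PosetBlocks.hasRealizer_pi d _) hB
    refine ⟨PosetBlocks.Hung (Fin d → Fin n), inferInstance, inferInstance, hB,
      le_antisymm (PosetBlocks.dim_le_of_blocks hd _ hB) ?_⟩
    refine le_of_not_gt fun hlt => ?_
    have hle : PosetBlocks.dim (PosetBlocks.Hung (Fin d → Fin n)) ≤ ((d + 1 : ℕ) : ℕ∞) :=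
      Order.le_of_lt_add_one (by convert hlt using 1; push_cast; rw [add_assoc]; norm_num)
    have := hn ((PosetBlocks.dim_le_iff (by omega)).1 hle)
    omega
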